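/- Let $\mathcal F^2(\mathbb C)$ be the Fock space of entire functions $f$ with $\frac1\pi\int_{\mathbb C}|f(z)|^2e^{-|z|^2}\,dV(z)<\infty$, and let $U$ be the Segal–Bargmann transform $Uf(z)=\int_{\mathbb R}A(z,x)f(x)\,dx$, where $A(z,x)=\pi^{-1/4}e^{(-z^2+2\sqrt2\,xz-x^2)/2}$. This $U$ is a unitary operator from $L^2(\mathbb R)$ onto $\mathcal F^2(\mathbb C)$. For a tempered distribution $u$ on $\mathbb R$ put likewise $Uu(z)=\langle u,A(z,\cdot)\rangle$ (bilinear pairing), and let $Xu(x)=xu(x)$ and $Pu=-iu'$ act on tempered distributions. Let $\kappa\ge 0$ be an integer, $\alpha_{j,p}\in\mathbb C$ for $0\le j,p\le\kappa$, and $\psi_p(z)=\sum_{j=0}^{\kappa}\alpha_{j,p}z^j$. For $f\in\mathcal F^2(\mathbb C)$ let $\mathcal D[\psi]f=\sum_{p=0}^{\kappa}\psi_pf^{(p)}$, and let $T_{\max}$ be the maximal differential operator on $\mathcal F^2(\mathbb C)$: $\operatorname{dom}(T_{\max})=\{f\in\mathcal F^2(\mathbb C):\mathcal D[\psi]f\in\mathcal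 F^2(\mathbb C)\}$, $T_{\max}f=\mathcal D[\psi]f$. Let $$E=\sum_{p=0}^{\kappa}\sum_{j=0}^{\kappa}\alpha_{j,p}\Big(\frac{X-iP}{\sqrt2}\Big)^j\Big(\frac{X+iP}{\sqrt2}\Big)^p$$ and let $L_{\max}$ be the maximal differential operator on $L^2(\mathbb R)$ induced by $E$: $\operatorname{dom}(L_{\max})=\{f\in L^2(\mathbb R):Ef\in L^2(\mathbb R)\}$ with $Ef$ taken in the sense of distributions, and $L_{\max}f=Ef$. Then $$\mathcal D[\psi]=U\,E\,U^{-1}\quad\text{on }\mathcal F^2(\mathbb C),\qquad\text{i.e. } \mathcal D[\psi]f(z)=\big(U(E(U^{-1}f))\big)(z)\ \text{ for all } f\in\mathcal F^2(\mathbb C),\ z\in\mathbb C,$$ and $$T_{\max}=U\,L_{\max}\,U^{-1},$$ an equality of unbounded operators including their domains, where $\operatorname{dom}(UL_{\max}U^{-1})=\{f:U^{-1}f\in\operatorname{dom}(L_{\max})\}$. -/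

import Mathlib

open MeasureTheory
open scoped SchwartzMap ContDiff

noncomputable section

/-! ### The Fock space -/

/-- The Gaussian measure `π⁻¹ exp (-|z|²) dV(z)` on `ℂ`. -/
def fockMeasure : Measure ℂ :=
  (volume : Measure ℂ).withDensity
    (fun z => ENNReal.ofReal (Real.pi⁻¹ * Real.exp (-‖z‖ ^ 2)))

/-- The space of entire functions that are square integrable for the Gaussian measure. -/
def fockSubmodule : Submodule ℂ (ℂ → ℂ) where
  carrier := {f | Differentiable ℂ f ∧ MemLp f 2 fockMeasure}
  zero_mem' := ⟨differentiable_const 0, MemLp.zero⟩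
  add_mem' := fun hf hg => ⟨hf.1.add hg.1, hf.2.add hg.2⟩
  smul_mem' := fun c _ hf => ⟨hf.1.const_smul c, hf.2.const_smul c⟩

/-- The Fock space: entire functions, square integrable for the Gaussian measure. It is a type of
its own, so that it carries the Hilbert norm and not the topology of pointwise convergence. -/
def FockSpace : Type := fockSubmodule

namespace FockSpace

instance : AddCommGroup FockSpace := inferInstanceAs (AddCommGroup fockSubmodule)

instance : Module ℂ FockSpace := inferInstanceAs (Module ℂ fockSubmodule)

/-- The inclusion of the Fock space into the space of all functions `ℂ → ℂ`. -/
def toFunₗ : FockSpace →ₗ[ℂ] (ℂ → ℂ) := fockSubmodule.subtype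

instance : CoeFun FockSpace (fun _ => ℂ → ℂ) := ⟨fun f => toFunₗ f⟩

theorem toFunₗ_injective : Function.Injective toFunₗ := Subtype.val_injective

theorem differentiable (f : FockSpace) : Differentiable ℂ f := f.2.1

theorem memLp (f : FockSpace) : MemLp f 2 fockMeasure := f.2.2

/-- The inclusion of the Fock space into `L²` of the Gaussian measure. -/
def toLp : FockSpace →ₗ[ℂ] Lp ℂ 2 fockMeasure where
  toFun f := f.memLp.toLp f
  map_add' _ _ := rfl
  map_smul' _ _ := rfl

theorem toLp_injective : Function.Injective toLp := by
  have hac : (volume : Measure ℂ) ≪ fockMeasure := by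
    apply withDensity_absolutelyContinuous'
    · exact (by fun_prop : Measurable (fun z : ℂ =>
        ENNReal.ofReal (Real.pi⁻¹ * Real.exp (-‖z‖ ^ 2)))).aemeasurable
    · exact Filter.Eventually.of_forall fun z => by
        have : 0 < Real.pi⁻¹ * Real.exp (-‖z‖ ^ 2) := by positivity
        simpa using this
  have : fockMeasure.IsOpenPosMeasure := hac.isOpenPosMeasure
  intro f g h
  apply toFunₗ_injective
  have h' : (f : ℂ → ℂ) =ᵐ[fockMeasure] g := (MemLp.toLp_eq_toLp_iff f.memLp g.memLp).1 h
  exact (Continuous.ae_eq_iff_eq fockMeasure f.differentiable.continuous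
    g.differentiable.continuous).1 h'

instance : NormedAddCommGroup FockSpace :=
  NormedAddCommGroup.induced FockSpace (Lp ℂ 2 fockMeasure) toLp toLp_injective

/-- The inner product of the Fock space is the one of `L²` of the Gaussian measure. -/
instance : InnerProductSpace ℂ FockSpace where
  norm_smul_le c f := norm_smul_le c (toLp f)
  inner f g := inner ℂ (toLp f) (toLp g)
  norm_sq_eq_re_inner f := norm_sq_eq_re_inner (𝕜 := ℂ) (toLp f)
  conj_inner_symm f g := inner_conj_symm (toLp f) (toLp g)
  add_left f g h := inner_add_left (𝕜 := ℂ) (toLp f) (toLp g) (toLp h)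
  smul_left f g c := inner_smul_left (𝕜 := ℂ) (toLp f) (toLp g) c

/-- The inner product of the Fock space in integral form (conjugate-linear in the first slot). -/
theorem inner_eq_integral (f g : FockSpace) :
    inner ℂ f g = (Real.pi : ℂ)⁻¹ *
      ∫ z : ℂ, g z * (starRingEnd ℂ) (f z) * Complex.exp (-(‖z‖ : ℂ) ^ 2) := by
  have h1 : inner ℂ f g = inner ℂ (toLp f) (toLp g) := rfl
  rw [h1, L2.inner_def]
  have h2 : ∫ z, inner ℂ (toLp f z) (toLp g z) ∂fockMeasure
      = ∫ z, g z * (starRingEnd ℂ) (f z) ∂fockMeasure := by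
    apply integral_congr_ae
    filter_upwards [f.memLp.coeFn_toLp, g.memLp.coeFn_toLp] with z hf hg
    change inner ℂ ((f.memLp.toLp f) z) ((g.memLp.toLp g) z) = _
    rw [hf, hg]
    simp [RCLike.inner_apply]
  rw [h2, fockMeasure, integral_withDensity_eq_integral_toReal_smul (by fun_prop) (by simp),
    ← integral_const_mul]
  congr 1
  ext z
  rw [ENNReal.toReal_ofReal (by positivity), Complex.real_smul]
  push_cast
  ring

end FockSpace

/-! ### Maximal differential operators on the Fock space -/

/-- The differential expression `𝒟[ψ] f = ∑_{p ≤ κ} ψ_p f^{(p)}` on the Fock space; the result is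
a function on `ℂ`, in general not in the Fock space. -/
def fockDiffExpr (κ : ℕ) (ψ : ℕ → ℂ → ℂ) : FockSpace →ₗ[ℂ] (ℂ → ℂ) where
  toFun f := fun z => ∑ p ∈ Finset.range (κ + 1), ψ p z * iteratedDeriv p f z
  map_add' f g := by
    ext z
    have h : ∀ p : ℕ, iteratedDeriv p (FockSpace.toFunₗ f + FockSpace.toFunₗ g) z
        = iteratedDeriv p f z + iteratedDeriv p g z := fun p =>
      iteratedDeriv_add f.differentiable.contDiff.contDiffAt g.differentiable.contDiff.contDiffAt
    simp only [map_add, h, mul_add, Finset.sum_add_distrib, Pi.add_apply]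
  map_smul' c f := by
    ext z
    have h : ∀ p : ℕ, iteratedDeriv p (c • FockSpace.toFunₗ f) z = c • iteratedDeriv p f z :=
      fun p => iteratedDeriv_const_smul f.differentiable.contDiff.contDiffAt c
    simp only [map_smul, h, smul_eq_mul, Pi.smul_apply, RingHom.id_apply, Finset.mul_sum]
    exact Finset.sum_congr rfl fun p _ => by ring

/-- The maximal differential operator `T_max` on the Fock space: its domain consists of all `f` in
the Fock space such that `𝒟[ψ] f` is in the Fock space, and `T_max f = 𝒟[ψ] f`. -/
def fockMaxOp (κ : ℕ) (ψ : ℕ → ℂ → ℂ) : FockSpace →ₗ.[ℂ] FockSpace where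
  domain := fockSubmodule.comap (fockDiffExpr κ ψ)
  toFun := ((fockDiffExpr κ ψ).comp (Submodule.subtype _)).codRestrict fockSubmodule
    (fun f => f.2)

theorem fockMaxOp_apply (κ : ℕ) (ψ : ℕ → ℂ → ℂ) (f : (fockMaxOp κ ψ).domain) (z : ℂ) :
    fockMaxOp κ ψ f z
      = ∑ p ∈ Finset.range (κ + 1), ψ p z * iteratedDeriv p (f : FockSpace) z := rfl

/-! ### Maximal differential operators on `L²(ℝ)` -/

/-- The Lebesgue space `L²(ℝ)` of complex-valued functions. -/
abbrev L2R : Type := Lp ℂ 2 (volume : Measure ℝ)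

/-- The inclusion of `L²(ℝ)` into the tempered distributions, `φ ↦ ∫ φ(x) f(x) dx`. -/
def distOfL2 : L2R →ₗ[ℂ] 𝓢'(ℝ, ℂ) :=
  (Lp.toTemperedDistributionCLM ℂ (volume : Measure ℝ) 2).toLinearMap

theorem distOfL2_injective : Function.Injective distOfL2 :=
  LinearMap.ker_eq_bot.1 Lp.ker_toTemperedDistributionCLM_eq_bot

/-- The operator `X`, multiplication by `x`, on tempered distributions. -/
def opX : Module.End ℂ 𝓢'(ℝ, ℂ) :=
  (TemperedDistribution.smulLeftCLM ℂ (fun x : ℝ => (x : ℂ))).toLinearMap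

/-- The operator `P = -i d/dx` on tempered distributions. -/
def opP : Module.End ℂ 𝓢'(ℝ, ℂ) :=
  (-Complex.I) • (TemperedDistribution.derivCLM ℂ).toLinearMap

theorem opX_apply (u : 𝓢'(ℝ, ℂ)) (φ : 𝓢(ℝ, ℂ)) :
    opX u φ = u (SchwartzMap.smulLeftCLM ℂ (fun x : ℝ => (x : ℂ)) φ) := rfl

theorem opP_apply (u : 𝓢'(ℝ, ℂ)) (φ : 𝓢(ℝ, ℂ)) :
    opP u φ = Complex.I * u (SchwartzMap.derivCLM ℂ ℂ φ) := by
  simp [opP, TemperedDistribution.derivCLM_apply_apply]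

/-- The expression `∑_{p ≤ κ} ∑_{j ≤ κ} α_{j,p} ((X - iP)/√2)^j ((X + iP)/√2)^p`, with all
derivatives taken in the sense of distributions. -/
def ladderExpr (κ : ℕ) (α : ℕ → ℕ → ℂ) : Module.End ℂ 𝓢'(ℝ, ℂ) :=
  ∑ p ∈ Finset.range (κ + 1), ∑ j ∈ Finset.range (κ + 1),
    α j p • ((((√2 : ℝ) : ℂ)⁻¹ • (opX - Complex.I • opP)) ^ j *
      (((√2 : ℝ) : ℂ)⁻¹ • (opX + Complex.I • opP)) ^ p)

/-- The maximal operator on `L²(ℝ)` induced by an expression `E` acting on distributions: its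
domain consists of all `f` in `L²(ℝ)` such that the distribution `E f` is (given by) an element of
`L²(ℝ)`, and this element is the value at `f`. For expressions with polynomial coefficients,
testing `E f` against Schwartz functions or against compactly supported smooth functions is the
same, since the latter are dense in the former. -/
def l2MaxOp (E : Module.End ℂ 𝓢'(ℝ, ℂ)) : L2R →ₗ.[ℂ] L2R where
  domain := (LinearMap.range distOfL2).comap (E ∘ₗ distOfL2)
  toFun := (LinearEquiv.ofInjective distOfL2 distOfL2_injective).symm.toLinearMap ∘ₗ
    ((E ∘ₗ distOfL2).comp (Submodule.subtype _)).codRestrict (LinearMap.range distOfL2)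
      (fun f => f.2)

theorem distOfL2_l2MaxOp (E : Module.End ℂ 𝓢'(ℝ, ℂ)) (f : (l2MaxOp E).domain) :
    distOfL2 (l2MaxOp E f) = E (distOfL2 f) :=
  congrArg Subtype.val ((LinearEquiv.ofInjective distOfL2 distOfL2_injective).apply_symm_apply
    (⟨E (distOfL2 f), f.2⟩ : LinearMap.range distOfL2))

/-! ### The Segal–Bargmann transform -/

/-- The kernel `A(z, x) = π^{-1/4} exp ((-z² + 2√2 x z - x²) / 2)`. -/
def sbKernel (z : ℂ) (x : ℝ) : ℂ :=
  ((Real.pi ^ (-(1 / 4) : ℝ) : ℝ) : ℂ) *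
    Complex.exp ((-z ^ 2 + 2 * ((√2 : ℝ) : ℂ) * (x : ℂ) * z - (x : ℂ) ^ 2) / 2)

theorem sbKernel_hasDerivAt (z : ℂ) (x : ℝ) :
    HasDerivAt (sbKernel z) ((((√2 : ℝ) : ℂ) * z - x) * sbKernel z x) x := by
  have h : HasDerivAt (fun y : ℂ => ((Real.pi ^ (-(1 / 4) : ℝ) : ℝ) : ℂ) *
      Complex.exp ((-z ^ 2 + 2 * ((√2 : ℝ) : ℂ) * y * z - y ^ 2) / 2))
      (((Real.pi ^ (-(1 / 4) : ℝ) : ℝ) : ℂ) *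
        (Complex.exp ((-z ^ 2 + 2 * ((√2 : ℝ) : ℂ) * (x : ℂ) * z - (x : ℂ) ^ 2) / 2) *
          ((2 * ((√2 : ℝ) : ℂ) * 1 * z - (2 : ℕ) * (x : ℂ) ^ 1 * 1) / 2))) (x : ℂ) := by
    refine HasDerivAt.const_mul _ (HasDerivAt.cexp (HasDerivAt.div_const ?_ 2))
    refine HasDerivAt.sub ?_ ((hasDerivAt_id (x : ℂ)).pow 2)
    exact (((hasDerivAt_id (x : ℂ)).const_mul _).mul_const z).const_add _
  refine h.comp_ofReal.congr_deriv ?_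
  simp only [sbKernel]
  push_cast
  ring

theorem sbKernel_contDiff (z : ℂ) : ContDiff ℝ ∞ (sbKernel z) := by
  unfold sbKernel
  have : ContDiff ℝ ∞ (fun x : ℝ => (x : ℂ)) := Complex.ofRealCLM.contDiff
  fun_prop

theorem sbKernel_iteratedDeriv (z : ℂ) (n : ℕ) :
    ∃ Q : Polynomial ℂ, ∀ x : ℝ, iteratedDeriv n (sbKernel z) x = Q.eval (x : ℂ) * sbKernel z x := by
  induction n with
  | zero => exact ⟨1, fun x => by simp⟩
  | succ n ih =>
    obtain ⟨Q, hQ⟩ := ih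
    refine ⟨Q.derivative + Q * (Polynomial.C (((√2 : ℝ) : ℂ) * z) - Polynomial.X), fun x => ?_⟩
    have hfun : iteratedDeriv n (sbKernel z) = fun y : ℝ => Q.eval (y : ℂ) * sbKernel z y :=
      funext hQ
    rw [iteratedDeriv_succ, hfun]
    refine (((Q.hasDerivAt (x : ℂ)).comp_ofReal).mul (sbKernel_hasDerivAt z x)).deriv.trans ?_
    simp only [Polynomial.eval_add, Polynomial.eval_mul, Polynomial.eval_sub, Polynomial.eval_C,
      Polynomial.eval_X]
    ring

theorem sbKernel_bound (z : ℂ) (m : ℕ) : ∃ C : ℝ, ∀ x : ℝ, |x| ^ m * ‖sbKernel z x‖ ≤ C := by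
  set b : ℝ := √2 * |z.re| + 1 with hb
  refine ⟨m.factorial * (Real.pi ^ (-(1 / 4) : ℝ) *
    Real.exp (-(z ^ 2).re / 2 + b ^ 2 / 2)), fun x => ?_⟩
  have hre : ((-z ^ 2 + 2 * ((√2 : ℝ) : ℂ) * (x : ℂ) * z - (x : ℂ) ^ 2) / 2).re
      = -(z ^ 2).re / 2 + (√2 * z.re * x - x ^ 2 / 2) := by
    have h : (-z ^ 2 + 2 * ((√2 : ℝ) : ℂ) * (x : ℂ) * z - (x : ℂ) ^ 2) / 2
        = ((-(1 / 2) : ℝ) : ℂ) * z ^ 2 + ((√2 * x : ℝ) : ℂ) * z + ((-(x ^ 2 / 2) : ℝ) : ℂ) := by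
      push_cast
      ring
    rw [h, Complex.add_re, Complex.add_re, Complex.re_ofReal_mul, Complex.re_ofReal_mul,
      Complex.ofReal_re]
    ring
  have hnorm : ‖sbKernel z x‖ = Real.pi ^ (-(1 / 4) : ℝ) *
      Real.exp (-(z ^ 2).re / 2 + (√2 * z.re * x - x ^ 2 / 2)) := by
    rw [sbKernel, norm_mul, Complex.norm_exp, hre, Complex.norm_real, Real.norm_of_nonneg]
    positivity
  have hpow : |x| ^ m ≤ m.factorial * Real.exp |x| := by
    have := Real.pow_div_factorial_le_exp |x| (abs_nonneg x) m
    rw [div_le_iff₀ (by positivity)] at this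
    linarith
  have hexp : |x| + (√2 * z.re * x - x ^ 2 / 2) ≤ b ^ 2 / 2 := by
    have h1 : z.re * x ≤ |z.re| * |x| := (le_abs_self _).trans (abs_mul _ _).le
    have h2 : √2 * (z.re * x) ≤ √2 * (|z.re| * |x|) := by gcongr
    have h3 := sq_nonneg (|x| - b)
    have h4 : |x| ^ 2 = x ^ 2 := sq_abs x
    have h5 : b * |x| = √2 * (|z.re| * |x|) + |x| := by rw [hb]; ring
    nlinarith
  calc |x| ^ m * ‖sbKernel z x‖
      ≤ (m.factorial * Real.exp |x|) * ‖sbKernel z x‖ := by gcongr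
    _ = m.factorial * (Real.pi ^ (-(1 / 4) : ℝ) *
        Real.exp (-(z ^ 2).re / 2 + (|x| + (√2 * z.re * x - x ^ 2 / 2)))) := by
        rw [hnorm, show -(z ^ 2).re / 2 + (|x| + (√2 * z.re * x - x ^ 2 / 2))
          = |x| + (-(z ^ 2).re / 2 + (√2 * z.re * x - x ^ 2 / 2)) by ring, Real.exp_add |x|]
        ring
    _ ≤ _ := by gcongr

theorem sbKernel_decay (z : ℂ) (k n : ℕ) :
    ∃ C : ℝ, ∀ x : ℝ, ‖x‖ ^ k * ‖iteratedFDeriv ℝ n (sbKernel z) x‖ ≤ C := by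
  obtain ⟨Q, hQ⟩ := sbKernel_iteratedDeriv z n
  choose C hC using fun m => sbKernel_bound z m
  refine ⟨∑ i ∈ Finset.range (Q.natDegree + 1), ‖Q.coeff i‖ * C (k + i), fun x => ?_⟩
  rw [norm_iteratedFDeriv_eq_norm_iteratedDeriv, hQ, norm_mul, Polynomial.eval_eq_sum_range]
  calc ‖x‖ ^ k * (‖∑ i ∈ Finset.range (Q.natDegree + 1), Q.coeff i * (x : ℂ) ^ i‖ * ‖sbKernel z x‖)
      ≤ ‖x‖ ^ k * ((∑ i ∈ Finset.range (Q.natDegree + 1), ‖Q.coeff i‖ * |x| ^ i) *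
          ‖sbKernel z x‖) := by
        gcongr
        refine (norm_sum_le _ _).trans (le_of_eq ?_)
        simp
    _ = ∑ i ∈ Finset.range (Q.natDegree + 1), ‖Q.coeff i‖ * (|x| ^ (k + i) * ‖sbKernel z x‖) := by
        rw [Finset.sum_mul, Finset.mul_sum]
        refine Finset.sum_congr rfl fun i _ => ?_
        rw [Real.norm_eq_abs, pow_add]
        ring
    _ ≤ _ := by
        gcongr with i _
        exact hC _ x

/-- For fixed `z`, the kernel `A(z, ·)` is a Schwartz function. -/
def sbKernelSchwartz (z : ℂ) : 𝓢(ℝ, ℂ) where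
  toFun := sbKernel z
  smooth' := sbKernel_contDiff z
  decay' := sbKernel_decay z

/-- The Segal–Bargmann transform of a tempered distribution `u`, that is the function
`z ↦ ⟨u, A(z, ·)⟩`. For `u` in `L²(ℝ)` this is `∫ A(z, x) u(x) dx`. -/
def sbTransform (u : 𝓢'(ℝ, ℂ)) (z : ℂ) : ℂ := u (sbKernelSchwartz z)

theorem sbTransform_distOfL2 (f : L2R) (z : ℂ) :
    sbTransform (distOfL2 f) z = ∫ x : ℝ, sbKernel z x * f x :=
  Lp.toTemperedDistribution_apply f (sbKernelSchwartz z)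

/-! ### Unitary equivalence of unbounded operators -/

/-- The operator `U L U⁻¹`, with domain `{f | U⁻¹ f ∈ dom L}`. -/
def conjOp (U : L2R ≃ₗᵢ[ℂ] FockSpace) (L : L2R →ₗ.[ℂ] L2R) : FockSpace →ₗ.[ℂ] FockSpace where
  domain := L.domain.comap U.symm.toLinearEquiv.toLinearMap
  toFun := U.toLinearEquiv.toLinearMap ∘ₗ L.toFun ∘ₗ
    (U.symm.toLinearEquiv.toLinearMap.restrict (fun _ h => h))

theorem conjOp_apply (U : L2R ≃ₗᵢ[ℂ] FockSpace) (L : L2R →ₗ.[ℂ] L2R) (f : (conjOp U L).domain) :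
    conjOp U L f = U (L ⟨U.symm f, f.2⟩) := rfl

end

/-! Write `A† = (X - iP)/√2` and `A = (X + iP)/√2`. The kernel satisfies `∂ₓ A(z,x) = (√2 z - x)
A(z,x)` and `∂_z A(z,x) = (√2 x - z) A(z,x)`. By the first identity the transform turns `A†` into
multiplication by `z`, on every tempered distribution. By the second it turns `A` into `d/dz`,
provided that differentiation may be carried through the pairing. Together they give `𝒟[ψ] = U E
U⁻¹`.

Since `E f` is in general only a distribution, the analysis takes place in a class
(`IsLadderGenerated`) that contains `L²` and is stable under both ladder operators. Its generators
are the `X^k f` with `f` in `L²`, where pairings are absolutely convergent integrals; the rest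
follows by induction along `A†`, sums and scalars.

Equality of domains needs more: if `U(E f) = U g` with `g` in `L²`, then `E f = g` as distributions.
This is injectivity of the transform on the class
(`IsLadderGenerated.eq_zero_of_sbTransform_eq_zero`). On the imaginary axis the transform of `u` is,
up to a Gaussian factor, the Fourier transform of `A(0,·) u`; if it vanishes then so does `A(0,·)
u`, and `A(0,·)` has no zeros.

Unitarity uses the same facts. The functions `A(w,·)` in `L²` and `exp(w ·)` in the Fock space have
the same Gram matrix; the former are total by injectivity, the latter by the reproducing property.
-/

noncomputable section

open Filter Topology FourierTransform

/-! ### Ladder operators on tempered distributions -/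

/-- The creation operator `(X - iP)/√2` on tempered distributions. -/
def creationOp : Module.End ℂ 𝓢'(ℝ, ℂ) := ((√2 : ℝ) : ℂ)⁻¹ • (opX - Complex.I • opP)

/-- The annihilation operator `(X + iP)/√2` on tempered distributions. -/
def annihilationOp : Module.End ℂ 𝓢'(ℝ, ℂ) := ((√2 : ℝ) : ℂ)⁻¹ • (opX + Complex.I • opP)

/-- Multiplication of Schwartz functions by `x`. -/
abbrev mulX : 𝓢(ℝ, ℂ) →L[ℂ] 𝓢(ℝ, ℂ) := SchwartzMap.smulLeftCLM ℂ (fun x : ℝ => (x : ℂ))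

theorem mulX_apply (φ : 𝓢(ℝ, ℂ)) (x : ℝ) : mulX φ x = x * φ x :=
  SchwartzMap.smulLeftCLM_apply_apply (by fun_prop) φ x

theorem ofReal_sqrt_two_sq : ((√2 : ℝ) : ℂ) ^ 2 = 2 := by
  rw [← Complex.ofReal_pow, Real.sq_sqrt (by norm_num)]
  norm_num

theorem ofReal_sqrt_two_ne_zero : ((√2 : ℝ) : ℂ) ≠ 0 := by
  simp

theorem creationOp_apply (u : 𝓢'(ℝ, ℂ)) (φ : 𝓢(ℝ, ℂ)) :
    creationOp u φ = ((√2 : ℝ) : ℂ)⁻¹ * u (mulX φ + SchwartzMap.derivCLM ℂ ℂ φ) := by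
  change ((√2 : ℝ) : ℂ)⁻¹ * (opX u φ - Complex.I * opP u φ) = _
  rw [opX_apply, opP_apply, map_add]
  linear_combination (-((√2 : ℝ) : ℂ)⁻¹ * u (SchwartzMap.derivCLM ℂ ℂ φ)) * Complex.I_sq

/-- Thanks to this, `A` needs no separate induction: stability under `X` and `A†` suffices. -/
theorem annihilationOp_eq : annihilationOp = ((√2 : ℝ) : ℂ) • opX - creationOp := by
  have h : ((√2 : ℝ) : ℂ) = ((√2 : ℝ) : ℂ)⁻¹ * 2 := by
    rw [← ofReal_sqrt_two_sq]
    field_simp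
  have h2 : ((√2 : ℝ) : ℂ) • opX = (((√2 : ℝ) : ℂ)⁻¹ * 2) • opX := by rw [← h]
  rw [h2, annihilationOp, creationOp]
  module

theorem derivCLM_mulX (φ : 𝓢(ℝ, ℂ)) :
    SchwartzMap.derivCLM ℂ ℂ (mulX φ) = φ + mulX (SchwartzMap.derivCLM ℂ ℂ φ) := by
  ext x
  have h : (mulX φ : ℝ → ℂ) = fun x : ℝ => (x : ℂ) * φ x := funext fun x => mulX_apply φ x
  rw [SchwartzMap.derivCLM_apply, h, add_apply, mulX_apply, SchwartzMap.derivCLM_apply]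
  have h1 : HasDerivAt (fun x : ℝ => (x : ℂ)) 1 x := Complex.ofRealCLM.hasDerivAt
  have := (h1.mul φ.differentiableAt.hasDerivAt).deriv
  rw [one_mul] at this
  exact this

/-- The commutation relation of `X` and `A†`, which is Leibniz' rule for `x φ`. It lets powers of
`X` be moved to the right of all `A†`, next to the `L²` function. -/
theorem opX_creationOp (u : 𝓢'(ℝ, ℂ)) :
    opX (creationOp u) = creationOp (opX u) + ((√2 : ℝ) : ℂ)⁻¹ • u := by
  ext φ
  change creationOp u (mulX φ) = creationOp (opX u) φ + ((√2 : ℝ) : ℂ)⁻¹ * u φ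
  rw [creationOp_apply, creationOp_apply, opX_apply]
  simp only [derivCLM_mulX, map_add]
  ring

/-! ### Distributions generated from `L²` by ladder operators -/

/-- The tempered distributions obtained from square integrable functions by applying polynomial
differential operators. -/
inductive IsLadderGenerated : 𝓢'(ℝ, ℂ) → Prop
  | opX_pow (k : ℕ) (f : L2R) : IsLadderGenerated ((opX ^ k) (distOfL2 f))
  | creationOp {u : 𝓢'(ℝ, ℂ)} : IsLadderGenerated u → IsLadderGenerated (creationOp u)
  | add {u v : 𝓢'(ℝ, ℂ)} : IsLadderGenerated u → IsLadderGenerated v → IsLadderGenerated (u + v)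
  | smul (c : ℂ) {u : 𝓢'(ℝ, ℂ)} : IsLadderGenerated u → IsLadderGenerated (c • u)

namespace IsLadderGenerated

theorem distOfL2 (f : L2R) : IsLadderGenerated (distOfL2 f) := opX_pow 0 f

theorem sub {u v : 𝓢'(ℝ, ℂ)} (hu : IsLadderGenerated u) (hv : IsLadderGenerated v) :
    IsLadderGenerated (u - v) := by
  have := hu.add (hv.smul (-1))
  rwa [neg_one_smul ℂ v, ← sub_eq_add_neg] at this

theorem sum {ι : Type*} (s : Finset ι) (u : ι → 𝓢'(ℝ, ℂ))
    (h : ∀ i ∈ s, IsLadderGenerated (u i)) : IsLadderGenerated (∑ i ∈ s, u i) := by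
  refine Finset.sum_induction _ _ (fun _ _ => add) ?_ h
  have := distOfL2 0
  rwa [map_zero] at this

theorem opX {u : 𝓢'(ℝ, ℂ)} (hu : IsLadderGenerated u) : IsLadderGenerated (opX u) := by
  induction hu with
  | opX_pow k f =>
    have := opX_pow (k + 1) f
    rwa [pow_succ'] at this
  | creationOp hu ih =>
    rw [opX_creationOp]
    exact ih.creationOp.add (hu.smul _)
  | add _ _ ihu ihv =>
    rw [map_add]
    exact ihu.add ihv
  | smul c _ ih =>
    rw [map_smul]
    exact ih.smul c

theorem annihilationOp {u : 𝓢'(ℝ, ℂ)} (hu : IsLadderGenerated u) :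
    IsLadderGenerated (annihilationOp u) := by
  rw [annihilationOp_eq]
  exact (hu.opX.smul _).sub hu.creationOp

theorem creationOp_pow {u : 𝓢'(ℝ, ℂ)} (hu : IsLadderGenerated u) (n : ℕ) :
    IsLadderGenerated ((_root_.creationOp ^ n) u) := by
  induction n with
  | zero => exact hu
  | succ n ih =>
    rw [pow_succ']
    exact ih.creationOp

theorem annihilationOp_pow {u : 𝓢'(ℝ, ℂ)} (hu : IsLadderGenerated u) (n : ℕ) :
    IsLadderGenerated ((_root_.annihilationOp ^ n) u) := by
  induction n with
  | zero => exact hu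
  | succ n ih =>
    rw [pow_succ']
    exact ih.annihilationOp

theorem ladderExpr {u : 𝓢'(ℝ, ℂ)} (hu : IsLadderGenerated u) (κ : ℕ) (α : ℕ → ℕ → ℂ) :
    IsLadderGenerated (ladderExpr κ α u) := by
  rw [_root_.ladderExpr, LinearMap.sum_apply]
  refine sum _ _ fun p _ => ?_
  rw [LinearMap.sum_apply]
  exact sum _ _ fun j _ => ((hu.annihilationOp_pow p).creationOp_pow j).smul _

end IsLadderGenerated

theorem opX_pow_distOfL2_apply (k : ℕ) (f : L2R) (φ : 𝓢(ℝ, ℂ)) :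
    (opX ^ k) (distOfL2 f) φ = ∫ x : ℝ, (x : ℂ) ^ k * φ x * f x := by
  induction k generalizing φ with
  | zero =>
    have : distOfL2 f φ = ∫ x : ℝ, φ x • f x := Lp.toTemperedDistribution_apply f φ
    simpa using this
  | succ k ih =>
    rw [pow_succ']
    change (opX ^ k) (distOfL2 f) (mulX φ) = _
    rw [ih]
    refine integral_congr_ae (.of_forall fun x => ?_)
    simp only [mulX_apply]
    ring

theorem SchwartzMap.integrable_mul_L2R (φ : 𝓢(ℝ, ℂ)) (f : L2R) :
    Integrable (fun x : ℝ => φ x * f x) :=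
  (φ.memLp 2).integrable_mul (Lp.memLp f)

theorem SchwartzMap.integrable_pow_mul_L2R (k : ℕ) (φ : 𝓢(ℝ, ℂ)) (f : L2R) :
    Integrable (fun x : ℝ => (x : ℂ) ^ k * φ x * f x) := by
  have := (SchwartzMap.smulLeftCLM ℂ (fun x : ℝ => (x : ℂ) ^ k) φ).integrable_mul_L2R f
  refine this.congr (.of_forall fun x => ?_)
  simp only
  rw [SchwartzMap.smulLeftCLM_apply_apply (by fun_prop), smul_eq_mul]

/-! ### Action of ladder operators on the Segal–Bargmann transform -/

theorem sbKernelSchwartz_apply (z : ℂ) (x : ℝ) : sbKernelSchwartz z x = sbKernel z x := rfl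

theorem derivCLM_sbKernelSchwartz (z : ℂ) :
    SchwartzMap.derivCLM ℂ ℂ (sbKernelSchwartz z)
      = (((√2 : ℝ) : ℂ) * z) • sbKernelSchwartz z - mulX (sbKernelSchwartz z) := by
  ext x
  rw [SchwartzMap.derivCLM_apply, sub_apply, smul_apply, mulX_apply,
    smul_eq_mul, ← sub_mul]
  exact (sbKernel_hasDerivAt z x).deriv

/-- The transpose of `A†` is `(X + d/dx)/√2`; since `∂ₓ A(z,x) = (√2 z - x) A(z,x)`, the kernel is
an eigenvector of it with eigenvalue `z`. -/
theorem sbTransform_creationOp (u : 𝓢'(ℝ, ℂ)) (z : ℂ) :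
    sbTransform (creationOp u) z = z * sbTransform u z := by
  rw [sbTransform, creationOp_apply, derivCLM_sbKernelSchwartz, add_sub_cancel, map_smul,
    smul_eq_mul, sbTransform]
  field_simp [ofReal_sqrt_two_ne_zero]

theorem sbTransform_add (u v : 𝓢'(ℝ, ℂ)) (z : ℂ) :
    sbTransform (u + v) z = sbTransform u z + sbTransform v z := rfl

theorem sbTransform_smul (c : ℂ) (u : 𝓢'(ℝ, ℂ)) (z : ℂ) :
    sbTransform (c • u) z = c * sbTransform u z := rfl

theorem sbTransform_sub (u v : 𝓢'(ℝ, ℂ)) (z : ℂ) :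
    sbTransform (u - v) z = sbTransform u z - sbTransform v z := rfl

theorem sbTransform_annihilationOp (u : 𝓢'(ℝ, ℂ)) (z : ℂ) :
    sbTransform (annihilationOp u) z
      = ((√2 : ℝ) : ℂ) * sbTransform (opX u) z - z * sbTransform u z := by
  rw [annihilationOp_eq, ← sbTransform_creationOp]
  rfl

theorem hasDerivAt_sbKernel_left (z : ℂ) (x : ℝ) :
    HasDerivAt (fun w => sbKernel w x) ((((√2 : ℝ) : ℂ) * x - z) * sbKernel z x) z := by
  have h : HasDerivAt (fun y : ℂ => ((Real.pi ^ (-(1 / 4) : ℝ) : ℝ) : ℂ) *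
      Complex.exp ((-y ^ 2 + 2 * ((√2 : ℝ) : ℂ) * (x : ℂ) * y - (x : ℂ) ^ 2) / 2))
      (((Real.pi ^ (-(1 / 4) : ℝ) : ℝ) : ℂ) *
        (Complex.exp ((-z ^ 2 + 2 * ((√2 : ℝ) : ℂ) * (x : ℂ) * z - (x : ℂ) ^ 2) / 2) *
          ((-((2 : ℕ) * z ^ 1 * 1) + 2 * ((√2 : ℝ) : ℂ) * (x : ℂ) * 1) / 2))) z := by
    refine HasDerivAt.const_mul _ (HasDerivAt.cexp (HasDerivAt.div_const ?_ 2))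
    refine HasDerivAt.sub_const _ ?_
    exact ((hasDerivAt_id z).pow 2).neg.add ((hasDerivAt_id z).const_mul _)
  refine h.congr_deriv ?_
  simp only [sbKernel]
  push_cast
  ring

theorem norm_sbKernel (z : ℂ) (x : ℝ) : ‖sbKernel z x‖ = Real.pi ^ (-(1 / 4) : ℝ) *
    Real.exp (-(z ^ 2).re / 2 + (√2 * z.re * x - x ^ 2 / 2)) := by
  have h : (-z ^ 2 + 2 * ((√2 : ℝ) : ℂ) * (x : ℂ) * z - (x : ℂ) ^ 2) / 2
      = ((-(1 / 2) : ℝ) : ℂ) * z ^ 2 + ((√2 * x : ℝ) : ℂ) * z + ((-(x ^ 2 / 2) : ℝ) : ℂ) := by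
    push_cast
    ring
  have hre : ((-z ^ 2 + 2 * ((√2 : ℝ) : ℂ) * (x : ℂ) * z - (x : ℂ) ^ 2) / 2).re
      = -(z ^ 2).re / 2 + (√2 * z.re * x - x ^ 2 / 2) := by
    rw [h, Complex.add_re, Complex.add_re, Complex.re_ofReal_mul, Complex.re_ofReal_mul,
      Complex.ofReal_re]
    ring
  rw [sbKernel, norm_mul, Complex.norm_exp, hre, Complex.norm_real, Real.norm_of_nonneg]
  positivity

/-- Provides a majorant, uniform on a disc, that is again made of kernels and hence integrable
against `x^k f`. The growth in `x` is at most `exp(√2 R |x|)`, attained by `A(R,·)` for `x ≥ 0` and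
by `A(-R,·)` for `x < 0`; replacing `-Re z²/2` by `-R²/2` costs at most the factor `exp(R²)`. -/
theorem norm_sbKernel_le {z : ℂ} {R : ℝ} (hz : ‖z‖ ≤ R) (x : ℝ) :
    ‖sbKernel z x‖ ≤ Real.exp (R ^ 2) * (‖sbKernel R x‖ + ‖sbKernel (-R) x‖) := by
  have hR : 0 ≤ R := (norm_nonneg z).trans hz
  have h1 : -(z ^ 2).re ≤ R ^ 2 := by
    calc -(z ^ 2).re ≤ |(z ^ 2).re| := neg_le_abs _
      _ ≤ ‖z ^ 2‖ := Complex.abs_re_le_norm _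
      _ = ‖z‖ ^ 2 := norm_pow _ _
      _ ≤ R ^ 2 := by gcongr
  have h2 : z.re * x ≤ R * |x| := by
    calc z.re * x ≤ |z.re * x| := le_abs_self _
      _ = |z.re| * |x| := abs_mul _ _
      _ ≤ R * |x| := by gcongr; exact (Complex.abs_re_le_norm z).trans hz
  have h3 : √2 * (z.re * x) ≤ √2 * (R * |x|) := by gcongr
  have key : ‖sbKernel z x‖ ≤ Real.pi ^ (-(1 / 4) : ℝ) *
      Real.exp (R ^ 2 + (-(R ^ 2) / 2 + (√2 * R * |x| - x ^ 2 / 2))) := by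
    rw [norm_sbKernel]
    refine mul_le_mul_of_nonneg_left (Real.exp_le_exp.2 ?_) (by positivity)
    linarith
  refine key.trans ?_
  have hpR : ‖sbKernel R x‖ = Real.pi ^ (-(1 / 4) : ℝ) *
      Real.exp (-(R ^ 2) / 2 + (√2 * R * x - x ^ 2 / 2)) := by
    rw [norm_sbKernel, ← Complex.ofReal_pow, Complex.ofReal_re, Complex.ofReal_re]
  have hmR : ‖sbKernel (-R) x‖ = Real.pi ^ (-(1 / 4) : ℝ) *
      Real.exp (-(R ^ 2) / 2 + (√2 * R * (-x) - x ^ 2 / 2)) := by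
    rw [norm_sbKernel, neg_sq, ← Complex.ofReal_pow, Complex.ofReal_re, Complex.neg_re,
      Complex.ofReal_re]
    ring_nf
  rw [Real.exp_add (R ^ 2), ← mul_assoc, mul_comm _ (Real.exp (R ^ 2)), mul_assoc]
  refine mul_le_mul_of_nonneg_left ?_ (Real.exp_pos _).le
  rcases abs_cases x with ⟨h, _⟩ | ⟨h, _⟩
  · rw [h, ← hpR]
    exact le_add_of_nonneg_right (norm_nonneg _)
  · rw [h, ← hmR]
    exact le_add_of_nonneg_left (norm_nonneg _)

theorem hasDerivAt_integral_pow_mul_sbKernel (k : ℕ) (f : L2R) (z₀ : ℂ) :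
    HasDerivAt (fun z => ∫ x : ℝ, (x : ℂ) ^ k * sbKernel z x * f x)
      (∫ x : ℝ, (x : ℂ) ^ k * ((((√2 : ℝ) : ℂ) * x - z₀) * sbKernel z₀ x) * f x) z₀ := by
  set R : ℝ := ‖z₀‖ + 1 with hR
  have hint (j : ℕ) (z : ℂ) : Integrable (fun x : ℝ => (x : ℂ) ^ j * sbKernel z x * f x) :=
    (sbKernelSchwartz z).integrable_pow_mul_L2R j f
  have hD : (fun x : ℝ => (x : ℂ) ^ k * ((((√2 : ℝ) : ℂ) * x - z₀) * sbKernel z₀ x) * f x)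
      = fun x : ℝ => ((√2 : ℝ) : ℂ) * ((x : ℂ) ^ (k + 1) * sbKernel z₀ x * f x)
        - z₀ * ((x : ℂ) ^ k * sbKernel z₀ x * f x) := by
    ext x
    ring
  refine (hasDerivAt_integral_of_dominated_loc_of_deriv_le
    (F' := fun z x => (x : ℂ) ^ k * ((((√2 : ℝ) : ℂ) * x - z) * sbKernel z x) * f x)
    (bound := fun x : ℝ => √2 * Real.exp (R ^ 2) * (‖(x : ℂ) ^ (k + 1) * sbKernel R x * f x‖
      + ‖(x : ℂ) ^ (k + 1) * sbKernel (-R) x * f x‖) + R * Real.exp (R ^ 2) *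
      (‖(x : ℂ) ^ k * sbKernel R x * f x‖ + ‖(x : ℂ) ^ k * sbKernel (-R) x * f x‖))
    (Metric.ball_mem_nhds z₀ one_pos)
    (.of_forall fun z => (hint k z).aestronglyMeasurable) (hint k z₀) ?_
    (.of_forall fun x z hz => ?_) ?_ (.of_forall fun x z _ => ?_)).2
  · rw [hD]
    exact (((hint _ _).const_mul _).sub ((hint _ _).const_mul _)).aestronglyMeasurable
  · have hzR : ‖z‖ ≤ R := by
      have h1 := norm_le_norm_add_norm_sub z₀ z
      have h2 : ‖z₀ - z‖ < 1 := by rwa [← dist_eq_norm, dist_comm]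
      linarith
    have hn : ‖((√2 : ℝ) : ℂ) * x - z‖ ≤ √2 * |x| + R := by
      refine (norm_sub_le _ _).trans ?_
      rw [norm_mul, Complex.norm_real, Complex.norm_real, Real.norm_eq_abs, Real.norm_eq_abs,
        abs_of_nonneg (Real.sqrt_nonneg 2)]
      linarith
    simp only [norm_mul, norm_pow, Complex.norm_real, Real.norm_eq_abs]
    calc |x| ^ k * (‖((√2 : ℝ) : ℂ) * x - z‖ * ‖sbKernel z x‖) * ‖f x‖
        ≤ |x| ^ k * ((√2 * |x| + R) *
          (Real.exp (R ^ 2) * (‖sbKernel R x‖ + ‖sbKernel (-R) x‖))) * ‖f x‖ := by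
          gcongr
          exact norm_sbKernel_le hzR x
      _ = _ := by ring
  · exact (((hint _ _).norm.add (hint _ _).norm).const_mul _).add
      (((hint _ _).norm.add (hint _ _).norm).const_mul _)
  · exact ((hasDerivAt_sbKernel_left z x).const_mul _).mul_const _

/-- On `X^k f` this is differentiation under the integral, and `√2 X - z` represents `A` after the
transform. In the step along `A†`, the product rule for `z · Uu` matches the commutator `A A† - A† A
= 1`. -/
theorem IsLadderGenerated.hasDerivAt_sbTransform {u : 𝓢'(ℝ, ℂ)} (hu : IsLadderGenerated u)
    (z : ℂ) : HasDerivAt (sbTransform u) (sbTransform (_root_.annihilationOp u) z) z := by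
  induction hu with
  | opX_pow k f =>
    have h : sbTransform ((_root_.opX ^ k) (_root_.distOfL2 f))
        = fun z => ∫ x : ℝ, (x : ℂ) ^ k * sbKernel z x * f x :=
      funext fun z => opX_pow_distOfL2_apply k f _
    rw [h]
    refine (hasDerivAt_integral_pow_mul_sbKernel k f z).congr_deriv ?_
    have h1 : _root_.opX ((_root_.opX ^ k) (_root_.distOfL2 f))
        = (_root_.opX ^ (k + 1)) (_root_.distOfL2 f) := by
      rw [pow_succ']
      rfl
    rw [sbTransform_annihilationOp, h1, sbTransform, sbTransform, opX_pow_distOfL2_apply,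
      opX_pow_distOfL2_apply, ← integral_const_mul, ← integral_const_mul, ← integral_sub]
    · refine integral_congr_ae (.of_forall fun x => ?_)
      simp only [sbKernelSchwartz_apply]
      ring
    · exact ((sbKernelSchwartz z).integrable_pow_mul_L2R (k + 1) f).const_mul _
    · exact ((sbKernelSchwartz z).integrable_pow_mul_L2R k f).const_mul _
  | @creationOp u hu ih =>
    have h : sbTransform (_root_.creationOp u) = fun z => z * sbTransform u z :=
      funext (sbTransform_creationOp u)
    rw [h]
    refine ((hasDerivAt_id z).mul ih).congr_deriv ?_
    simp only [sbTransform_annihilationOp, opX_creationOp, sbTransform_add, sbTransform_smul,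
      sbTransform_creationOp, id]
    field_simp [ofReal_sqrt_two_ne_zero]
    ring
  | add _ _ ihu ihv =>
    rw [map_add]
    exact ihu.add ihv
  | smul c _ ih =>
    rw [map_smul]
    exact ih.const_mul c

theorem iteratedDeriv_sbTransform {u : 𝓢'(ℝ, ℂ)} (hu : IsLadderGenerated u) (p : ℕ) :
    iteratedDeriv p (sbTransform u) = sbTransform ((annihilationOp ^ p) u) := by
  induction p with
  | zero => simp
  | succ p ih =>
    rw [iteratedDeriv_succ, ih, pow_succ']
    exact funext fun z => ((hu.annihilationOp_pow p).hasDerivAt_sbTransform z).deriv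

theorem sbTransform_creationOp_pow (u : 𝓢'(ℝ, ℂ)) (j : ℕ) (z : ℂ) :
    sbTransform ((creationOp ^ j) u) z = z ^ j * sbTransform u z := by
  induction j with
  | zero => simp
  | succ j ih =>
    rw [pow_succ', Module.End.mul_apply, sbTransform_creationOp, ih]
    ring

theorem sbTransform_sum {ι : Type*} (s : Finset ι) (u : ι → 𝓢'(ℝ, ℂ)) (z : ℂ) :
    sbTransform (∑ i ∈ s, u i) z = ∑ i ∈ s, sbTransform (u i) z := by
  induction s using Finset.cons_induction with
  | empty => rfl
  | cons i s hi ih => rw [Finset.sum_cons, Finset.sum_cons, sbTransform_add, ih]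

/-- The Segal–Bargmann transform turns an expression in the ladder operators into a differential
expression with polynomial coefficients. -/
theorem sbTransform_ladderExpr {u : 𝓢'(ℝ, ℂ)} (hu : IsLadderGenerated u) (κ : ℕ)
    (α : ℕ → ℕ → ℂ) (z : ℂ) :
    sbTransform (ladderExpr κ α u) z = ∑ p ∈ Finset.range (κ + 1),
      (∑ j ∈ Finset.range (κ + 1), α j p * z ^ j) * iteratedDeriv p (sbTransform u) z := by
  rw [ladderExpr, LinearMap.sum_apply, sbTransform_sum]
  refine Finset.sum_congr rfl fun p _ => ?_
  rw [LinearMap.sum_apply, sbTransform_sum, Finset.sum_mul]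
  refine Finset.sum_congr rfl fun j _ => ?_
  rw [iteratedDeriv_sbTransform hu, mul_assoc, ← sbTransform_creationOp_pow]
  rfl

/-! ### Injectivity of the Segal–Bargmann transform -/

/-- At `z = -√2 π i ξ` one has `-z²/2 = π² ξ²` and `√2 x z = -2π i x ξ`, so the kernel is a Gaussian
in `ξ` times the Fourier character times `A(0,x)`. -/
theorem exp_mul_sbKernel_imaginary (ξ x : ℝ) :
    Complex.exp (-(Real.pi ^ 2 * ξ ^ 2 : ℝ)) * sbKernel (-((√2 : ℝ) : ℂ) * Real.pi * Complex.I * ξ) x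
      = Complex.exp (((-2 * Real.pi * x * ξ : ℝ) : ℂ) * Complex.I) * sbKernel 0 x := by
  rw [sbKernel, sbKernel, mul_left_comm, mul_left_comm (Complex.exp _), ← Complex.exp_add,
    ← Complex.exp_add]
  congr 2
  push_cast
  linear_combination (-(Real.pi : ℂ) ^ 2 * ξ ^ 2 * Complex.I ^ 2 / 2
    - Real.pi * x * ξ * Complex.I) * ofReal_sqrt_two_sq - (Real.pi : ℂ) ^ 2 * ξ ^ 2 * Complex.I_sq

theorem fourier_pow_mul_sbKernel (k : ℕ) (f : L2R) (ξ : ℝ) :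
    𝓕 (fun x : ℝ => (x : ℂ) ^ k * sbKernel 0 x * f x) ξ
      = Complex.exp (-(Real.pi ^ 2 * ξ ^ 2 : ℝ)) *
        sbTransform ((opX ^ k) (distOfL2 f)) (-((√2 : ℝ) : ℂ) * Real.pi * Complex.I * ξ) := by
  rw [Real.fourier_real_eq_integral_exp_smul, sbTransform, opX_pow_distOfL2_apply,
    ← integral_const_mul]
  refine integral_congr_ae (.of_forall fun x => ?_)
  have := exp_mul_sbKernel_imaginary ξ x
  simp only [sbKernelSchwartz_apply, smul_eq_mul] at this ⊢
  linear_combination (-(x : ℂ) ^ k * f x) * this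

theorem integral_fourier_mul_eq_of_integrable (θ : 𝓢(ℝ, ℂ)) {h : ℝ → ℂ} (hh : Integrable h) :
    Integrable (fun ξ => θ ξ * 𝓕 h ξ) ∧ ∫ x, (𝓕 θ : 𝓢(ℝ, ℂ)) x * h x = ∫ ξ, θ ξ * 𝓕 h ξ := by
  refine ⟨?_, ?_⟩
  · refine (θ.integrable (μ := volume)).mul_bdd (c := ∫ x, ‖h x‖) ?_ (.of_forall fun ξ => ?_)
    · exact (VectorFourier.fourierIntegral_continuous Real.continuous_fourierChar
        (by fun_prop) hh).aestronglyMeasurable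
    · exact VectorFourier.norm_fourierIntegral_le_integral_norm _ _ _ _ _
  · have := VectorFourier.integral_fourierIntegral_smul_eq_flip (L := innerₗ ℝ)
      Real.continuous_fourierChar (by fun_prop) (θ.integrable (μ := volume)) hh
    rw [flip_innerₗ] at this
    exact this

theorem derivCLM_fourier (θ : 𝓢(ℝ, ℂ)) :
    SchwartzMap.derivCLM ℂ ℂ (𝓕 θ : 𝓢(ℝ, ℂ)) = 𝓕 ((-2 * Real.pi * Complex.I : ℂ) • mulX θ) := by
  ext x
  have h1 : Integrable (fun x : ℝ => x • θ x) := by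
    refine (mulX θ).integrable.congr (.of_forall fun x => ?_)
    simp [mulX_apply]
  rw [SchwartzMap.derivCLM_apply, SchwartzMap.fourier_coe, SchwartzMap.fourier_coe,
    Real.deriv_fourier θ.integrable h1]
  refine congrArg (fun g : ℝ → ℂ => 𝓕 g x) (funext fun y => ?_)
  simp [mulX_apply, mul_assoc]

theorem SchwartzMap.smulLeftCLM_coe_apply (η φ : 𝓢(ℝ, ℂ)) (x : ℝ) :
    SchwartzMap.smulLeftCLM ℂ η φ x = η x * φ x :=
  SchwartzMap.smulLeftCLM_apply_apply η.hasTemperateGrowth φ x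

/-- As `A(0,·)' = -x A(0,·)`, the transpose of `√2 A†` only differentiates the factor `η`. -/
theorem mulX_add_deriv_mul_sbKernel_zero (η : 𝓢(ℝ, ℂ)) :
    mulX (SchwartzMap.smulLeftCLM ℂ η (sbKernelSchwartz 0))
      + SchwartzMap.derivCLM ℂ ℂ (SchwartzMap.smulLeftCLM ℂ η (sbKernelSchwartz 0))
      = SchwartzMap.smulLeftCLM ℂ (SchwartzMap.derivCLM ℂ ℂ η) (sbKernelSchwartz 0) := by
  ext x
  have h : (SchwartzMap.smulLeftCLM ℂ η (sbKernelSchwartz 0) : ℝ → ℂ)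
      = fun x => η x * sbKernel 0 x := funext (η.smulLeftCLM_coe_apply _)
  have hd : deriv (fun x => η x * sbKernel 0 x) x = _ :=
    (η.differentiableAt.hasDerivAt.mul (sbKernel_hasDerivAt 0 x)).deriv
  rw [add_apply, mulX_apply, SchwartzMap.smulLeftCLM_coe_apply, SchwartzMap.smulLeftCLM_coe_apply,
    SchwartzMap.derivCLM_apply, SchwartzMap.derivCLM_apply, h, sbKernelSchwartz_apply, hd]
  ring

/-- A distribution generated from `L²` tested on `𝓕 θ · A(0, ·)` is an average of values of its
Segal–Bargmann transform on the imaginary axis. -/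
theorem IsLadderGenerated.apply_fourier_mul_sbKernel {u : 𝓢'(ℝ, ℂ)} (hu : IsLadderGenerated u)
    (θ : 𝓢(ℝ, ℂ)) :
    Integrable (fun ξ : ℝ => θ ξ * (Complex.exp (-(Real.pi ^ 2 * ξ ^ 2 : ℝ)) *
      sbTransform u (-((√2 : ℝ) : ℂ) * Real.pi * Complex.I * ξ))) ∧
    u (SchwartzMap.smulLeftCLM ℂ (𝓕 θ : 𝓢(ℝ, ℂ)) (sbKernelSchwartz 0)) =
      ∫ ξ : ℝ, θ ξ * (Complex.exp (-(Real.pi ^ 2 * ξ ^ 2 : ℝ)) *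
        sbTransform u (-((√2 : ℝ) : ℂ) * Real.pi * Complex.I * ξ)) := by
  induction hu generalizing θ with
  | opX_pow k f =>
    obtain ⟨h1, h2⟩ := integral_fourier_mul_eq_of_integrable θ
      ((sbKernelSchwartz 0).integrable_pow_mul_L2R k f)
    simp only [sbKernelSchwartz_apply, fourier_pow_mul_sbKernel] at h1 h2
    refine ⟨h1, ?_⟩
    rw [← h2, opX_pow_distOfL2_apply]
    refine integral_congr_ae (.of_forall fun x => ?_)
    simp only [SchwartzMap.smulLeftCLM_coe_apply, sbKernelSchwartz_apply]
    ring
  | @creationOp u _ ih =>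
    -- Differentiating `𝓕 θ` multiplies `θ` by `-2π i ξ`, and `-2π i ξ / √2` is exactly the point
    -- `z` at which the transform is taken; hence the induction over all `θ`.
    obtain ⟨h1, h2⟩ := ih ((-2 * Real.pi * Complex.I : ℂ) • mulX θ)
    have h3 : ∀ ξ : ℝ, θ ξ * (Complex.exp (-(Real.pi ^ 2 * ξ ^ 2 : ℝ)) *
        sbTransform (_root_.creationOp u) (-((√2 : ℝ) : ℂ) * Real.pi * Complex.I * ξ))
        = ((√2 : ℝ) : ℂ)⁻¹ * (((-2 * Real.pi * Complex.I : ℂ) • mulX θ) ξ *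
          (Complex.exp (-(Real.pi ^ 2 * ξ ^ 2 : ℝ)) *
          sbTransform u (-((√2 : ℝ) : ℂ) * Real.pi * Complex.I * ξ))) := by
      intro ξ
      rw [sbTransform_creationOp, smul_apply, mulX_apply, smul_eq_mul]
      field_simp [ofReal_sqrt_two_ne_zero]
      rw [ofReal_sqrt_two_sq]
      ring
    simp only [h3]
    refine ⟨h1.const_mul _, ?_⟩
    rw [integral_const_mul, ← h2, creationOp_apply, mulX_add_deriv_mul_sbKernel_zero,
      derivCLM_fourier]
  | add _ _ ihu ihv =>
    obtain ⟨h1, h2⟩ := ihu θ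
    obtain ⟨h3, h4⟩ := ihv θ
    simp only [sbTransform_add, mul_add]
    exact ⟨h1.add h3, by rw [integral_add h1 h3, ← h2, ← h4]; rfl⟩
  | smul c _ ih =>
    obtain ⟨h1, h2⟩ := ih θ
    simp only [sbTransform_smul, mul_left_comm _ c]
    exact ⟨h1.const_mul c, by rw [integral_const_mul, ← h2]; rfl⟩

theorem IsLadderGenerated.apply_mul_sbKernel_eq_zero {u : 𝓢'(ℝ, ℂ)} (hu : IsLadderGenerated u)
    (h : sbTransform u = 0) (η : 𝓢(ℝ, ℂ)) :
    u (SchwartzMap.smulLeftCLM ℂ η (sbKernelSchwartz 0)) = 0 := by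
  have := (hu.apply_fourier_mul_sbKernel (𝓕⁻ η)).2
  rw [FourierTransform.fourier_fourierInv_eq] at this
  rw [this, h]
  simp

theorem hasTemperateGrowth_comp_mul (χ : 𝓢(ℝ, ℂ)) (ε : ℝ) :
    Function.HasTemperateGrowth (fun x : ℝ => χ (ε * x)) :=
  χ.hasTemperateGrowth.comp (by fun_prop)

theorem SchwartzMap.smulLeftCLM_comp_mul_apply (χ φ : 𝓢(ℝ, ℂ)) (ε x : ℝ) :
    SchwartzMap.smulLeftCLM ℂ (fun x : ℝ => χ (ε * x)) φ x = χ (ε * x) * φ x :=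
  SchwartzMap.smulLeftCLM_apply_apply (hasTemperateGrowth_comp_mul χ ε) φ x

/-- Leibniz' rule: the transpose of `√2 A†` commutes with the cutoff up to an error carrying a
factor `ε`. -/
theorem mulX_add_deriv_smulLeftCLM_comp_mul (χ φ : 𝓢(ℝ, ℂ)) (ε : ℝ) :
    mulX (SchwartzMap.smulLeftCLM ℂ (fun x : ℝ => χ (ε * x)) φ)
      + SchwartzMap.derivCLM ℂ ℂ (SchwartzMap.smulLeftCLM ℂ (fun x : ℝ => χ (ε * x)) φ)
    = SchwartzMap.smulLeftCLM ℂ (fun x : ℝ => χ (ε * x)) (mulX φ + SchwartzMap.derivCLM ℂ ℂ φ)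
      + (ε : ℂ) • SchwartzMap.smulLeftCLM ℂ
        (fun x : ℝ => SchwartzMap.derivCLM ℂ ℂ χ (ε * x)) φ := by
  ext x
  have h : (SchwartzMap.smulLeftCLM ℂ (fun x : ℝ => χ (ε * x)) φ : ℝ → ℂ)
      = fun x => χ (ε * x) * φ x := funext (χ.smulLeftCLM_comp_mul_apply φ ε)
  have hχ : HasDerivAt (fun x : ℝ => χ (ε * x)) (ε • deriv χ (ε * x)) x := by
    refine HasDerivAt.scomp x χ.differentiableAt.hasDerivAt ?_
    simpa using (hasDerivAt_id x).const_mul ε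
  simp only [add_apply, smul_apply, mulX_apply, SchwartzMap.smulLeftCLM_comp_mul_apply,
    SchwartzMap.derivCLM_apply, smul_eq_mul]
  have hd : deriv (fun x => χ (ε * x) * φ x) x = _ :=
    (hχ.mul φ.differentiableAt.hasDerivAt).deriv
  have hs : SchwartzMap.smulLeftCLM ℂ (fun x => deriv χ (ε * x)) φ x = deriv χ (ε * x) * φ x :=
    (SchwartzMap.derivCLM ℂ ℂ χ).smulLeftCLM_comp_mul_apply φ ε x
  rw [h, hs, hd, Complex.real_smul]
  ring

/-- Cutting off test functions by dilations of a Schwartz function. -/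
theorem IsLadderGenerated.tendsto_cutoff {u : 𝓢'(ℝ, ℂ)} (hu : IsLadderGenerated u)
    (χ φ : 𝓢(ℝ, ℂ)) :
    Tendsto (fun ε : ℝ => u (SchwartzMap.smulLeftCLM ℂ (fun x : ℝ => χ (ε * x)) φ)) (𝓝 0)
      (𝓝 (χ 0 * u φ)) := by
  induction hu generalizing χ φ with
  | opX_pow k f =>
    simp only [opX_pow_distOfL2_apply, SchwartzMap.smulLeftCLM_comp_mul_apply]
    rw [← integral_const_mul]
    have hint := φ.integrable_pow_mul_L2R k f
    refine tendsto_integral_filter_of_dominated_convergence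
      (fun x => SchwartzMap.seminorm ℝ 0 0 χ * ‖(x : ℂ) ^ k * φ x * f x‖) (.of_forall fun ε => ?_)
      (.of_forall fun ε => .of_forall fun x => ?_) (hint.norm.const_mul _)
      (.of_forall fun x => ?_)
    · have := (SchwartzMap.smulLeftCLM ℂ (fun x : ℝ => χ (ε * x)) φ).integrable_pow_mul_L2R k f
      simp only [SchwartzMap.smulLeftCLM_comp_mul_apply] at this
      exact this.aestronglyMeasurable
    · rw [show (x : ℂ) ^ k * (χ (ε * x) * φ x) * f x = χ (ε * x) * ((x : ℂ) ^ k * φ x * f x) by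
        ring, norm_mul]
      gcongr
      exact SchwartzMap.norm_le_seminorm ℝ χ _
    · have hc : Tendsto (fun ε : ℝ => χ (ε * x)) (𝓝 0) (𝓝 (χ 0)) := by
        have h : Continuous (fun ε : ℝ => χ (ε * x)) := χ.continuous.comp (by fun_prop)
        simpa using h.tendsto 0
      refine (hc.mul_const ((x : ℂ) ^ k * φ x * f x)).congr fun ε => ?_
      ring
  | @creationOp u _ ih =>
    simp only [creationOp_apply, mulX_add_deriv_smulLeftCLM_comp_mul, map_add _ _ (_ • _),
      map_smul]
    have h0 : Tendsto (fun ε : ℝ => (ε : ℂ)) (𝓝 0) (𝓝 0) := by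
      simpa using Complex.continuous_ofReal.tendsto 0
    have h1 := ih χ (mulX φ + SchwartzMap.derivCLM ℂ ℂ φ)
    -- The induction hypothesis for the cutoff `χ'` makes the error pairing converge, so the factor
    -- `ε` sends it to zero.
    have h2 := h0.smul (ih (SchwartzMap.derivCLM ℂ ℂ χ) φ)
    have h3 := (h1.add h2).const_mul (((√2 : ℝ) : ℂ)⁻¹)
    rw [zero_smul, add_zero, mul_left_comm] at h3
    exact h3
  | add _ _ ihu ihv =>
    have := (ihu χ φ).add (ihv χ φ)
    rw [← mul_add] at this
    exact this
  | smul c _ ih =>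
    have := (ih χ φ).const_mul c
    rw [mul_left_comm] at this
    exact this

theorem exists_schwartzMap_hasCompactSupport_eq_one :
    ∃ χ : 𝓢(ℝ, ℂ), HasCompactSupport χ ∧ χ 0 = 1 := by
  obtain ⟨b⟩ : Nonempty (ContDiffBump (0 : ℝ)) := inferInstance
  have hs : ContDiff ℝ ∞ (fun x => (b x : ℂ)) := Complex.ofRealCLM.contDiff.comp b.contDiff
  have hc : HasCompactSupport (fun x => (b x : ℂ)) :=
    b.hasCompactSupport.comp_left (g := Complex.ofReal) Complex.ofReal_zero
  refine ⟨hc.toSchwartzMap hs, hc, ?_⟩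
  have : b 0 = 1 := b.one_of_mem_closedBall (Metric.mem_closedBall_self b.rIn_pos.le)
  change (b 0 : ℂ) = 1
  rw [this, Complex.ofReal_one]

theorem IsLadderGenerated.eq_zero_of_sbTransform_eq_zero {u : 𝓢'(ℝ, ℂ)}
    (hu : IsLadderGenerated u) (h : sbTransform u = 0) : u = 0 := by
  obtain ⟨χ, hχc, h1⟩ := exists_schwartzMap_hasCompactSupport_eq_one
  ext φ
  have hlim := hu.tendsto_cutoff χ φ
  rw [h1, one_mul] at hlim
  -- The value `ε = 0` is excluded because `χ(0 · x)` is constant, hence not compactly supported.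
  refine tendsto_nhds_unique (hlim.mono_left (nhdsWithin_le_nhds (s := {0}ᶜ)))
    (tendsto_const_nhds.congr' ?_)
  filter_upwards [self_mem_nhdsWithin] with ε hε
  have hA : ∀ x, sbKernel 0 x ≠ 0 := fun x => by
    rw [sbKernel]
    exact mul_ne_zero (Complex.ofReal_ne_zero.2 (by positivity)) (Complex.exp_ne_zero _)
  have hqs : ContDiff ℝ ∞ (fun x : ℝ => χ (ε * x) * (sbKernel 0 x)⁻¹) := by
    refine ContDiff.mul ?_ ((sbKernel_contDiff 0).inv hA)
    exact (χ.smooth ⊤).comp (contDiff_const.mul contDiff_id)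
  have hqc : HasCompactSupport (fun x : ℝ => χ (ε * x) * (sbKernel 0 x)⁻¹) :=
    HasCompactSupport.mul_right (hχc.comp_homeomorph (Homeomorph.mulLeft₀ ε hε))
  -- `1/A(0,·)` grows like a Gaussian; compact support of the cutoff makes the quotient `q` a
  -- Schwartz function, so that `χ(ε·) φ = (q φ) A(0,·)`, on which `u` vanishes.
  obtain ⟨q, hq⟩ : ∃ q : 𝓢(ℝ, ℂ), ∀ x, q x = χ (ε * x) * (sbKernel 0 x)⁻¹ :=
    ⟨hqc.toSchwartzMap hqs, fun _ => rfl⟩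
  rw [zero_apply]
  rw [← hu.apply_mul_sbKernel_eq_zero h (SchwartzMap.smulLeftCLM ℂ q φ)]
  congr 1
  ext x
  rw [SchwartzMap.smulLeftCLM_coe_apply, SchwartzMap.smulLeftCLM_coe_apply,
    SchwartzMap.smulLeftCLM_comp_mul_apply, hq, sbKernelSchwartz_apply]
  field_simp [hA x]

/-! ### Reproducing kernels of the Fock space -/

/-- Mean value property of entire functions for the Gaussian weight. -/
theorem integral_mul_exp_neg_norm_sq {H : ℂ → ℂ} (hH : Differentiable ℂ H)
    (hint : Integrable fun v : ℂ => H v * Complex.exp (-(‖v‖ : ℂ) ^ 2)) :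
    ∫ v : ℂ, H v * Complex.exp (-(‖v‖ : ℂ) ^ 2) = Real.pi * H 0 := by
  set g : ℂ → ℂ := fun v => Complex.exp (-(‖v‖ : ℂ) ^ 2) with hg
  have hHc := hH.continuous
  -- The weight and the measure are invariant under rotations, so `H v` may be replaced by its
  -- average over the circle through `v`, which is `H 0`; Fubini exchanges the two integrals.
  have hcoe (θ : ℝ) : (rotation (Circle.exp θ) : ℂ → ℂ) = fun v => circleMap 0 1 θ * v := by
    ext v
    simp [circleMap]
  have hmp (θ : ℝ) : MeasurePreserving (fun v : ℂ => circleMap 0 1 θ * v) := by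
    have := (rotation (Circle.exp θ)).measurePreserving
    rwa [hcoe] at this
  have hme (θ : ℝ) : MeasurableEmbedding (fun v : ℂ => circleMap 0 1 θ * v) := by
    have := (rotation (Circle.exp θ)).toHomeomorph.measurableEmbedding
    rwa [LinearIsometryEquiv.coe_toHomeomorph, hcoe] at this
  have hgr (θ : ℝ) (v : ℂ) : g (circleMap 0 1 θ * v) = g v := by
    simp [hg, circleMap]
  have hrot (θ : ℝ) : Integrable fun v => H (circleMap 0 1 θ * v) * g v := by
    have := ((hmp θ).integrable_comp_emb (hme θ)).2 hint
    refine this.congr (.of_forall fun v => ?_)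
    simp only [Function.comp_apply]
    rw [← hgr θ v]
  have hval (θ : ℝ) : ∫ v, H (circleMap 0 1 θ * v) * g v = ∫ v, H v * g v := by
    have := (hmp θ).integral_comp (hme θ) fun v => H v * g v
    simpa only [hgr] using this
  have hnval (θ : ℝ) : ∫ v, ‖H (circleMap 0 1 θ * v) * g v‖ = ∫ v, ‖H v * g v‖ := by
    have := (hmp θ).integral_comp (hme θ) fun v => ‖H v * g v‖
    simpa only [hgr] using this
  have hprod : Integrable (Function.uncurry fun (θ : ℝ) (v : ℂ) => H (circleMap 0 1 θ * v) * g v)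
      ((volume.restrict (Set.uIoc 0 (2 * Real.pi))).prod volume) := by
    refine (integrable_prod_iff ?_).2 ⟨.of_forall hrot, ?_⟩
    · refine Continuous.aestronglyMeasurable ?_
      have : Continuous (fun p : ℝ × ℂ => circleMap 0 1 p.1) :=
        (continuous_circleMap 0 1).comp continuous_fst
      simp only [hg, Function.uncurry_def]
      fun_prop
    · simp only [Function.uncurry_apply_pair, hnval]
      exact intervalIntegrable_iff.1 intervalIntegrable_const
  have hswap := intervalIntegral_integral_swap hprod
  have havg (v : ℂ) : ∫ θ in (0 : ℝ)..2 * Real.pi, H (circleMap 0 1 θ * v)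
      = 2 * Real.pi * H 0 := by
    have hd : Differentiable ℂ (fun w => H (w * v)) := hH.comp (by fun_prop)
    have := circleAverage_of_differentiable_on_off_countable (f := fun w => H (w * v)) (c := 0)
      (R := 1) Set.countable_empty hd.continuous.continuousOn fun z _ => hd z
    rw [Real.circleAverage_def, zero_mul, inv_smul_eq_iff₀ (by positivity)] at this
    rw [this, Complex.real_smul]
    push_cast
    ring
  have hG : ∫ v, g v = Real.pi := by
    have := GaussianFourier.integral_cexp_neg_mul_sq_norm (b := 1) (V := ℂ) (by simp)
    simpa [hg] using this
  simp only [hval, intervalIntegral.integral_mul_const, havg, intervalIntegral.integral_const,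
    integral_const_mul, hG, sub_zero, Complex.real_smul] at hswap
  have hpi : (2 * Real.pi : ℂ) ≠ 0 := by simp [Real.pi_ne_zero]
  refine mul_left_cancel₀ hpi ?_
  push_cast at hswap
  linear_combination hswap

theorem integrable_fockMeasure_iff {E : Type*} [NormedAddCommGroup E] [NormedSpace ℝ E]
    {h : ℂ → E} : Integrable h fockMeasure ↔
      Integrable fun z => (Real.pi⁻¹ * Real.exp (-‖z‖ ^ 2)) • h z := by
  rw [fockMeasure, integrable_withDensity_iff_integrable_smul' (by fun_prop) (by simp)]
  refine integrable_congr (.of_forall fun z => ?_)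
  simp only
  rw [ENNReal.toReal_ofReal (by positivity)]

namespace FockSpace

theorem memLp_exp_mul (a : ℂ) : MemLp (fun z : ℂ => Complex.exp (z * a)) 2 fockMeasure := by
  rw [memLp_two_iff_integrable_sq_norm
    (by fun_prop : Continuous fun z : ℂ => Complex.exp (z * a)).aestronglyMeasurable,
    integrable_fockMeasure_iff]
  -- `|exp(z a)|² = exp(2 Re(z a))` and `Re(z a)` is the real inner product of `conj a` and `z`: a
  -- Gaussian with a linear term.
  have := (GaussianFourier.integrable_cexp_neg_mul_sq_norm_add (b := 1) (V := ℂ) (by simp) 2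
    (starRingEnd ℂ a)).norm.const_mul Real.pi⁻¹
  refine this.congr (.of_forall fun z => ?_)
  have h1 : (-1 * (‖z‖ : ℂ) ^ 2 + 2 * (inner ℝ (starRingEnd ℂ a) z : ℝ)).re
      = -‖z‖ ^ 2 + 2 * (z * a).re := by
    rw [← Complex.ofReal_pow, ← Complex.ofReal_one, ← Complex.ofReal_neg, ← Complex.ofReal_mul,
      ← Complex.ofReal_ofNat, ← Complex.ofReal_mul, ← Complex.ofReal_add, Complex.ofReal_re,
      Complex.inner, Complex.conj_conj]
    ring
  simp only [Complex.norm_exp, h1, smul_eq_mul]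
  rw [Real.exp_add, two_mul (z * a).re, Real.exp_add]
  ring

/-- The function `z ↦ exp (z a)`, the reproducing kernel of the Fock space at `conj a`. -/
def kernel (a : ℂ) : FockSpace :=
  ⟨fun z => Complex.exp (z * a), by fun_prop, memLp_exp_mul a⟩

theorem kernel_apply (a z : ℂ) : kernel a z = Complex.exp (z * a) := rfl

theorem integrable_mul_conj_mul_exp (f g : FockSpace) :
    Integrable fun z : ℂ => g z * (starRingEnd ℂ) (f z) * Complex.exp (-(‖z‖ : ℂ) ^ 2) := by
  have h := g.memLp.integrable_mul f.memLp.star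
  rw [integrable_fockMeasure_iff] at h
  refine (h.const_mul (Real.pi : ℂ)).congr (.of_forall fun z => ?_)
  simp only [Pi.mul_apply, Pi.star_apply, Complex.real_smul, RCLike.star_def]
  have : (Real.pi : ℂ) ≠ 0 := by simp [Real.pi_ne_zero]
  push_cast
  field_simp

/-- Translating by `b = conj a` completes the square: the integrand becomes the entire function `f(v
+ b) exp(-v a)` times the Gaussian weight, and the mean value property at `v = 0` gives `f b`. -/
theorem inner_kernel (a : ℂ) (f : FockSpace) : inner ℂ (kernel a) f = f (starRingEnd ℂ a) := by
  set b := starRingEnd ℂ a with hb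
  have hpt (v : ℂ) : f (v + b) * (starRingEnd ℂ) (kernel a (v + b)) *
      Complex.exp (-(‖v + b‖ : ℂ) ^ 2)
      = f (v + b) * Complex.exp (-(v * a)) * Complex.exp (-(‖v‖ : ℂ) ^ 2) := by
    rw [kernel_apply, ← Complex.exp_conj, mul_assoc, mul_assoc, ← Complex.exp_add,
      ← Complex.exp_add, ← Complex.mul_conj', ← Complex.mul_conj']
    congr 2
    simp only [map_mul, map_add, hb, Complex.conj_conj]
    ring
  have hint := (integrable_mul_conj_mul_exp (kernel a) f).comp_add_right b
  simp only [hpt] at hint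
  have hd : Differentiable ℂ fun v => f (v + b) * Complex.exp (-(v * a)) :=
    (f.differentiable.comp (by fun_prop)).mul (by fun_prop)
  rw [inner_eq_integral, ← integral_add_right_eq_self _ b]
  simp only [hpt]
  rw [integral_mul_exp_neg_norm_sq hd hint]
  have : (Real.pi : ℂ) ≠ 0 := by simp [Real.pi_ne_zero]
  simp [this]

theorem inner_kernel_kernel (a b : ℂ) :
    inner ℂ (kernel a) (kernel b) = Complex.exp (starRingEnd ℂ a * b) := by
  rw [inner_kernel, kernel_apply]

end FockSpace

/-! ### The Segal–Bargmann transform on `L²(ℝ)` -/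

theorem conj_sbKernel (z : ℂ) (x : ℝ) :
    starRingEnd ℂ (sbKernel z x) = sbKernel (starRingEnd ℂ z) x := by
  simp only [sbKernel, map_mul, ← Complex.exp_conj, Complex.conj_ofReal, map_div₀, map_sub,
    map_add, map_neg, map_pow, map_ofNat]

theorem integral_sbKernel_mul_sbKernel (z w : ℂ) :
    ∫ x : ℝ, sbKernel z x * sbKernel w x = Complex.exp (z * w) := by
  have h (x : ℝ) : sbKernel z x * sbKernel w x
      = (((Real.pi ^ (-(1 / 4) : ℝ) : ℝ) : ℂ) * ((Real.pi ^ (-(1 / 4) : ℝ) : ℝ) : ℂ)) *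
        Complex.exp (-1 * (x : ℂ) ^ 2 + (((√2 : ℝ) : ℂ) * (z + w)) * x + -(z ^ 2 + w ^ 2) / 2) := by
    rw [sbKernel, sbKernel, mul_mul_mul_comm, ← Complex.exp_add]
    congr 2
    ring
  have hc : ((Real.pi ^ (-(1 / 4) : ℝ) : ℝ) : ℂ) * ((Real.pi ^ (-(1 / 4) : ℝ) : ℝ) : ℂ)
      * ((Real.pi : ℂ) / - -1) ^ (1 / 2 : ℂ) = 1 := by
    have h1 : ((Real.pi : ℂ) / - -1) ^ (1 / 2 : ℂ) = ((Real.pi ^ (1 / 2 : ℝ) : ℝ) : ℂ) := by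
      rw [Complex.ofReal_cpow Real.pi_pos.le]
      norm_num
    rw [h1, ← Complex.ofReal_mul, ← Complex.ofReal_mul, ← Real.rpow_add Real.pi_pos,
      ← Real.rpow_add Real.pi_pos]
    norm_num
  simp only [h]
  rw [integral_const_mul, integral_cexp_quadratic (by simp), ← mul_assoc, hc, one_mul]
  congr 1
  linear_combination ((z + w) ^ 2 / 4) * ofReal_sqrt_two_sq

/-- The kernel `A(w, ·)` as an element of `L²(ℝ)`. -/
def sbKernelL2 (w : ℂ) : L2R := ((sbKernelSchwartz w).memLp 2).toLp

theorem coeFn_sbKernelL2 (w : ℂ) : sbKernelL2 w =ᵐ[volume] sbKernel w :=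
  ((sbKernelSchwartz w).memLp 2).coeFn_toLp

theorem inner_sbKernelL2 (w : ℂ) (f : L2R) :
    inner ℂ (sbKernelL2 w) f = ∫ x : ℝ, sbKernel (starRingEnd ℂ w) x * f x := by
  rw [L2.inner_def]
  refine integral_congr_ae ?_
  filter_upwards [coeFn_sbKernelL2 w] with x hx
  rw [hx, RCLike.inner_apply, conj_sbKernel, mul_comm]

theorem inner_sbKernelL2_sbKernelL2 (a b : ℂ) :
    inner ℂ (sbKernelL2 a) (sbKernelL2 b) = Complex.exp (starRingEnd ℂ a * b) := by
  rw [inner_sbKernelL2, ← integral_sbKernel_mul_sbKernel]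
  refine integral_congr_ae ?_
  filter_upwards [coeFn_sbKernelL2 b] with x hx
  rw [hx]

theorem sbTransform_distOfL2_eq_inner (f : L2R) (z : ℂ) :
    sbTransform (distOfL2 f) z = inner ℂ (sbKernelL2 (starRingEnd ℂ z)) f := by
  rw [sbTransform_distOfL2, inner_sbKernelL2, Complex.conj_conj]

theorem differentiable_sbTransform_distOfL2 (f : L2R) :
    Differentiable ℂ (sbTransform (distOfL2 f)) :=
  fun z => ((IsLadderGenerated.distOfL2 f).hasDerivAt_sbTransform z).differentiableAt

/-- An `f` orthogonal to every `A(w,·)` has zero transform, hence is zero by injectivity. -/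
theorem denseRange_linearCombination_sbKernelL2 :
    DenseRange (Finsupp.linearCombination ℂ sbKernelL2) := by
  have hort : (LinearMap.range (Finsupp.linearCombination ℂ sbKernelL2))ᗮ = ⊥ := by
    rw [Submodule.eq_bot_iff]
    intro f hf
    refine distOfL2_injective ?_
    rw [map_zero]
    refine (IsLadderGenerated.distOfL2 f).eq_zero_of_sbTransform_eq_zero (funext fun z => ?_)
    rw [sbTransform_distOfL2_eq_inner]
    refine (Submodule.mem_orthogonal _ _).1 hf _ ⟨Finsupp.single (starRingEnd ℂ z) 1, ?_⟩
    simp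
  exact Submodule.dense_iff_topologicalClosure_eq_top.2
    (Submodule.topologicalClosure_eq_top_iff.2 hort)

/-- Both families have Gram matrix `exp(conj a · b)`. -/
theorem norm_linearCombination_kernel (c : ℂ →₀ ℂ) :
    ‖Finsupp.linearCombination ℂ FockSpace.kernel c‖
      = ‖Finsupp.linearCombination ℂ sbKernelL2 c‖ := by
  have h : inner ℂ (Finsupp.linearCombination ℂ FockSpace.kernel c)
        (Finsupp.linearCombination ℂ FockSpace.kernel c)
      = inner ℂ (Finsupp.linearCombination ℂ sbKernelL2 c)
        (Finsupp.linearCombination ℂ sbKernelL2 c) := by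
    simp only [Finsupp.linearCombination_apply, Finsupp.sum, sum_inner, inner_sum,
      inner_smul_left, inner_smul_right, FockSpace.inner_kernel_kernel,
      inner_sbKernelL2_sbKernelL2]
  rw [inner_self_eq_norm_sq_to_K, inner_self_eq_norm_sq_to_K] at h
  have h' : ‖Finsupp.linearCombination ℂ FockSpace.kernel c‖ ^ 2
      = ‖Finsupp.linearCombination ℂ sbKernelL2 c‖ ^ 2 := by exact_mod_cast h
  exact (sq_eq_sq₀ (norm_nonneg _) (norm_nonneg _)).1 h'

theorem sbTransform_linearCombination_sbKernelL2 (c : ℂ →₀ ℂ) (z : ℂ) :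
    sbTransform (distOfL2 (Finsupp.linearCombination ℂ sbKernelL2 c)) z
      = Finsupp.linearCombination ℂ FockSpace.kernel c z := by
  rw [sbTransform_distOfL2_eq_inner, ← Complex.conj_conj z, ← FockSpace.inner_kernel]
  simp only [Finsupp.linearCombination_apply, Finsupp.sum, inner_sum, inner_smul_right,
    FockSpace.inner_kernel_kernel, inner_sbKernelL2_sbKernelL2, Complex.conj_conj]

/-- The isometric extension of `A(w, ·) ↦ exp (w ·)` to `L²(ℝ)`. -/
def sbToLp : L2R →L[ℂ] Lp ℂ 2 fockMeasure :=
  (FockSpace.toLp ∘ₗ Finsupp.linearCombination ℂ FockSpace.kernel).extendOfNorm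
    (Finsupp.linearCombination ℂ sbKernelL2)

theorem sbToLp_linearCombination (c : ℂ →₀ ℂ) :
    sbToLp (Finsupp.linearCombination ℂ sbKernelL2 c)
      = FockSpace.toLp (Finsupp.linearCombination ℂ FockSpace.kernel c) := by
  have h : ∃ C, ∀ c, ‖(FockSpace.toLp ∘ₗ Finsupp.linearCombination ℂ FockSpace.kernel) c‖
      ≤ C * ‖Finsupp.linearCombination ℂ sbKernelL2 c‖ :=
    ⟨1, fun c => (norm_linearCombination_kernel c).le.trans_eq (one_mul _).symm⟩
  exact LinearMap.extendOfNorm_eq denseRange_linearCombination_sbKernelL2 h c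

theorem norm_sbToLp (f : L2R) : ‖sbToLp f‖ = ‖f‖ := by
  refine denseRange_linearCombination_sbKernelL2.induction_on
    (p := fun f => ‖sbToLp f‖ = ‖f‖) f (isClosed_eq (by fun_prop) (by fun_prop)) fun c => ?_
  rw [sbToLp_linearCombination, ← norm_linearCombination_kernel]
  rfl

/-- The extension takes values in the complete space `L²` of the Gaussian measure, since
completeness of the Fock space is not yet known. A norm limit has a subsequence converging almost
everywhere, while the transforms converge at every point, being inner products with a fixed kernel;
the two limits agree. -/
theorem coeFn_sbToLp (f : L2R) : sbToLp f =ᵐ[fockMeasure] sbTransform (distOfL2 f) := by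
  obtain ⟨x, hx, hlim⟩ := mem_closure_iff_seq_limit.1
    (denseRange_linearCombination_sbKernelL2.closure_range ▸ Set.mem_univ f)
  choose c hc using hx
  obtain ⟨ns, hns, hae⟩ := (tendstoInMeasure_of_tendsto_Lp
    ((sbToLp.continuous.tendsto f).comp hlim)).exists_seq_tendsto_ae
  have hpt : ∀ᵐ z ∂fockMeasure, ∀ n, sbToLp (x n) z = sbTransform (distOfL2 (x n)) z := by
    rw [ae_all_iff]
    intro n
    rw [← hc n, sbToLp_linearCombination]
    filter_upwards [(FockSpace.memLp
      (Finsupp.linearCombination ℂ FockSpace.kernel (c n))).coeFn_toLp] with z hz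
    rw [sbTransform_linearCombination_sbKernelL2]
    exact hz
  filter_upwards [hae, hpt] with z h1 h2
  refine tendsto_nhds_unique h1 ?_
  simp only [Function.comp_apply, h2, sbTransform_distOfL2_eq_inner]
  exact tendsto_const_nhds.inner (hlim.comp hns.tendsto_atTop)

/-- The Segal–Bargmann transform of a square integrable function as an element of the Fock
space. -/
def sbFock (f : L2R) : FockSpace :=
  ⟨sbTransform (distOfL2 f), differentiable_sbTransform_distOfL2 f,
    (memLp_congr_ae (coeFn_sbToLp f)).1 (Lp.memLp (sbToLp f))⟩

theorem toLp_sbFock (f : L2R) : FockSpace.toLp (sbFock f) = sbToLp f := by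
  refine Lp.ext ?_
  exact (sbFock f).memLp.coeFn_toLp.trans (coeFn_sbToLp f).symm

theorem norm_sbFock (f : L2R) : ‖sbFock f‖ = ‖f‖ := by
  rw [← norm_sbToLp f, ← toLp_sbFock]
  rfl

/-- The Segal–Bargmann transform as an isometry from `L²(ℝ)` into the Fock space. -/
def segalBargmannₗᵢ : L2R →ₗᵢ[ℂ] FockSpace where
  toFun := sbFock
  map_add' f g := by
    apply FockSpace.toLp_injective
    simp only [map_add, toLp_sbFock]
  map_smul' c f := by
    apply FockSpace.toLp_injective
    simp only [map_smul, toLp_sbFock, RingHom.id_apply]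
  norm_map' := norm_sbFock

theorem toFunₗ_segalBargmannₗᵢ (f : L2R) :
    FockSpace.toFunₗ (segalBargmannₗᵢ f) = sbTransform (distOfL2 f) := rfl

theorem segalBargmannₗᵢ_sbKernelL2 (w : ℂ) :
    segalBargmannₗᵢ (sbKernelL2 w) = FockSpace.kernel w := by
  apply FockSpace.toFunₗ_injective
  ext z
  rw [toFunₗ_segalBargmannₗᵢ, sbTransform_distOfL2_eq_inner, inner_sbKernelL2_sbKernelL2, Complex.conj_conj,
    FockSpace.kernel_apply]

/-- The range of an isometry on a complete space is complete, and it contains all reproducing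
kernels; a function orthogonal to these vanishes at every point. -/
theorem segalBargmannₗᵢ_surjective : Function.Surjective segalBargmannₗᵢ := by
  have hc : IsComplete (LinearMap.range segalBargmannₗᵢ.toLinearMap : Set FockSpace) :=
    segalBargmannₗᵢ.isometry.isUniformInducing.isComplete_range
  have : CompleteSpace (LinearMap.range segalBargmannₗᵢ.toLinearMap) := hc.completeSpace_coe
  refine LinearMap.range_eq_top.1 (Submodule.orthogonal_eq_bot_iff.1 ?_)
  rw [Submodule.eq_bot_iff]
  intro f hf
  apply FockSpace.toFunₗ_injective
  ext z
  rw [← Complex.conj_conj z, ← FockSpace.inner_kernel, ← segalBargmannₗᵢ_sbKernelL2]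
  exact (Submodule.mem_orthogonal _ _).1 hf _ ⟨_, rfl⟩

/-- The Segal–Bargmann transform as a unitary operator from `L²(ℝ)` onto the Fock space. -/
def segalBargmann : L2R ≃ₗᵢ[ℂ] FockSpace :=
  LinearIsometryEquiv.ofSurjective segalBargmannₗᵢ segalBargmannₗᵢ_surjective

theorem toFunₗ_segalBargmann (f : L2R) :
    FockSpace.toFunₗ (segalBargmann f) = sbTransform (distOfL2 f) := rfl

theorem toFunₗ_eq_sbTransform_symm (f : FockSpace) :
    FockSpace.toFunₗ f = sbTransform (distOfL2 (segalBargmann.symm f)) := by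
  rw [← toFunₗ_segalBargmann, LinearIsometryEquiv.apply_symm_apply]

/-! ### Unitary equivalence of the maximal operators -/

theorem eq_of_sbTransform_eq {u v : 𝓢'(ℝ, ℂ)} (hu : IsLadderGenerated u) (hv : IsLadderGenerated v)
    (h : sbTransform u = sbTransform v) : u = v := by
  refine sub_eq_zero.1 ((hu.sub hv).eq_zero_of_sbTransform_eq_zero (funext fun z => ?_))
  rw [sbTransform_sub, h, sub_self, Pi.zero_apply]

theorem fockDiffExpr_eq_sbTransform {κ : ℕ} {α : ℕ → ℕ → ℂ} {ψ : ℕ → ℂ → ℂ}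
    (hψ : ∀ p ∈ Finset.range (κ + 1), ∀ z : ℂ,
      ψ p z = ∑ j ∈ Finset.range (κ + 1), α j p * z ^ j) (f : FockSpace) :
    fockDiffExpr κ ψ f = sbTransform (ladderExpr κ α (distOfL2 (segalBargmann.symm f))) := by
  ext z
  rw [sbTransform_ladderExpr (.distOfL2 _), ← toFunₗ_eq_sbTransform_symm]
  exact Finset.sum_congr rfl fun p hp => congrArg (· * _) (hψ p hp z)

/-- Compares the graphs of the two maximal operators. From right to left, the distribution on the
left is not known in advance to lie in `L²`, so injectivity is needed on the whole class of
ladder-generated distributions. -/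
theorem ladderExpr_distOfL2_eq_iff {κ : ℕ} {α : ℕ → ℕ → ℂ} {ψ : ℕ → ℂ → ℂ}
    (hψ : ∀ p ∈ Finset.range (κ + 1), ∀ z : ℂ,
      ψ p z = ∑ j ∈ Finset.range (κ + 1), α j p * z ^ j) (f g : FockSpace) :
    ladderExpr κ α (distOfL2 (segalBargmann.symm f)) = distOfL2 (segalBargmann.symm g)
      ↔ fockDiffExpr κ ψ f = FockSpace.toFunₗ g := by
  rw [fockDiffExpr_eq_sbTransform hψ, toFunₗ_eq_sbTransform_symm]
  exact ⟨fun h => by rw [h], eq_of_sbTransform_eq ((IsLadderGenerated.distOfL2 _).ladderExpr κ α)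
    (.distOfL2 _)⟩

theorem fockMaxOp_eq_conjOp {κ : ℕ} {α : ℕ → ℕ → ℂ} {ψ : ℕ → ℂ → ℂ}
    (hψ : ∀ p ∈ Finset.range (κ + 1), ∀ z : ℂ,
      ψ p z = ∑ j ∈ Finset.range (κ + 1), α j p * z ^ j) :
    fockMaxOp κ ψ = conjOp segalBargmann (l2MaxOp (ladderExpr κ α)) := by
  refine LinearPMap.ext ?_ fun f hf hf' => ?_
  · ext f
    constructor
    · intro hf
      exact ⟨segalBargmann.symm ⟨fockDiffExpr κ ψ f, hf⟩,
        ((ladderExpr_distOfL2_eq_iff hψ f ⟨fockDiffExpr κ ψ f, hf⟩).2 rfl).symm⟩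
    · rintro ⟨g, hg⟩
      have h := (ladderExpr_distOfL2_eq_iff hψ f (segalBargmann g)).1
        (by rw [LinearIsometryEquiv.symm_apply_apply]; exact hg.symm)
      change fockDiffExpr κ ψ f ∈ fockSubmodule
      rw [h]
      exact (segalBargmann g).2
  · rw [conjOp_apply, ← LinearIsometryEquiv.symm_apply_eq]
    apply distOfL2_injective
    rw [distOfL2_l2MaxOp]
    exact ((ladderExpr_distOfL2_eq_iff hψ f (fockMaxOp κ ψ ⟨f, hf⟩)).2 rfl).symm

end

theorem theorem5p2 :
    ∃ U : L2R ≃ₗᵢ[ℂ] FockSpace,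
      (∀ (f : L2R) (z : ℂ), U f z = ∫ x : ℝ, sbKernel z x * f x) ∧
      ∀ (κ : ℕ) (α : ℕ → ℕ → ℂ) (ψ : ℕ → ℂ → ℂ),
        (∀ p ∈ Finset.range (κ + 1), ∀ z : ℂ,
          ψ p z = ∑ j ∈ Finset.range (κ + 1), α j p * z ^ j) →
        (∀ f : FockSpace,
          fockDiffExpr κ ψ f = sbTransform (ladderExpr κ α (distOfL2 (U.symm f)))) ∧
        fockMaxOp κ ψ = conjOp U (l2MaxOp (ladderExpr κ α)) :=
  ⟨segalBargmann, fun f z => by rw [toFunₗ_segalBargmann, sbTransform_distOfL2], fun _ _ _ hψ =>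
    ⟨fockDiffExpr_eq_sbTransform hψ, fockMaxOp_eq_conjOp hψ⟩⟩
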